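/- Let $(X,Y)$ be a pair of real-valued random variables on a probability space, and let $\mathcal B$ be the Borel $\sigma$-field of $\mathbb R$. Let $\mathcal X := \{x\in\mathbb R : \mathbb P(X\le x)>0 \text{ and } \mathbb P(X\ge x)>0\}$ be the range of $X$. For sets $A,B\subset\mathbb R$ write $A<B$ if $a<b$ for all $a\in A$, $b\in B$. For probability measures $P,Q$ on $\mathbb R$ write $P\le_{\mathrm{lr}}Q$ if there exist a $\sigma$-finite measure $m$ and densities $f=\mathrm dP/\mathrm dm$, $g=\mathrm dQ/\mathrm dm$ with values in $[0,\infty)$ such that $g/f$ (with value $\infty$ where $f=0<g$) is nondecreasing on $\{f+g>0\}$. A version of the conditional distribution of $Y$ given $X$ is a stochastic kernel $K$ from $\mathbb R$ to $\mathbb R$ (each $K(x,\cdot)$ is a probability measure on $\mathcal B$, each $K(\cdot,B)$ is measurable) such that $\mathbb P(X\in A,\,Y\in B)=\mathbb E\bigl(1_A(X)K(X,B)\bigr)$ for all $A,B\in\mathcal B$. The following three conditions are equivalent: (i) For all Borel sets $A_1<A_2$ and $B_1<B_2$, $$\mathbb P(X\in A_1,Y\in B_2)\,\mathbb P(X\in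 A_2,Y\in B_1)\ \le\ \mathbb P(X\in A_1,Y\in B_1)\,\mathbb P(X\in A_2,Y\in B_2).\qquad(*)$$ (ii) For all real numbers $x_0<x_1<x_2$ and $y_0<y_1<y_2$, inequality $(*)$ holds with $A_1=(x_0,x_1]$, $A_2=(x_1,x_2]$, $B_1=(y_0,y_1]$, $B_2=(y_1,y_2]$. (iii) There is a version $K$ of the conditional distribution of $Y$ given $X$ such that $K(x_1,\cdot)\le_{\mathrm{lr}}K(x_2,\cdot)$ for all $x_1<x_2$ in $\mathcal X$. Moreover, if these conditions hold, then a kernel $K$ as in (iii) is given explicitly by $$K(x,(y,\infty))=\sup_{a<x}\,\mathbb P(Y>y\mid a<X\le x)\quad\text{for } x\in\mathcal X,\ y\in\mathbb R,$$ where $\mathbb P(\cdot\mid a<X\le x):=0$ if $\mathbb P(a<X\le x)=0$, and by letting $K(x,\cdot)$ be the distribution of $Y$ for $x\notin\mathcal X$. -/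

import Mathlib

open MeasureTheory ProbabilityTheory Set
open scoped NNReal ENNReal

namespace LRKernel

/-- Elementwise strict order between sets of reals: every element of `A` is smaller than every
element of `B`. -/
def SetLT (A B : Set ℝ) : Prop := ∀ a ∈ A, ∀ b ∈ B, a < b

/-- Likelihood ratio order `P ≤_lr Q`: there are a σ-finite measure `m` and densities
`f = dP/dm`, `g = dQ/dm` such that `g / f` is isotonic on `{f + g > 0}`. The quotient is taken in
`[0, ∞]`, so it is `∞` where `f = 0 < g`. -/
def LikelihoodRatioLE (P Q : Measure ℝ) : Prop :=
  ∃ (m : Measure ℝ) (f g : ℝ → ℝ≥0), SigmaFinite m ∧ Measurable f ∧ Measurable g ∧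
    P = m.withDensity (fun y => (f y : ℝ≥0∞)) ∧
    Q = m.withDensity (fun y => (g y : ℝ≥0∞)) ∧
    MonotoneOn (fun y => (g y : ℝ≥0∞) / (f y : ℝ≥0∞)) {y | 0 < f y + g y}

section RandomPair

variable {Ω : Type*} [MeasurableSpace Ω]

/-- The TP2 inequality for the pair `(X, Y)` and the given sets:
`ℙ(X ∈ A₁, Y ∈ B₂) ℙ(X ∈ A₂, Y ∈ B₁) ≤ ℙ(X ∈ A₁, Y ∈ B₁) ℙ(X ∈ A₂, Y ∈ B₂)`. -/
def TP2Ineq (μ : Measure Ω) (X Y : Ω → ℝ) (A₁ A₂ B₁ B₂ : Set ℝ) : Prop :=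
  μ (X ⁻¹' A₁ ∩ Y ⁻¹' B₂) * μ (X ⁻¹' A₂ ∩ Y ⁻¹' B₁)
    ≤ μ (X ⁻¹' A₁ ∩ Y ⁻¹' B₁) * μ (X ⁻¹' A₂ ∩ Y ⁻¹' B₂)

/-- The range of `X`: all real `x` with `ℙ(X ≤ x) > 0` and `ℙ(X ≥ x) > 0`. -/
def rangeOf (μ : Measure Ω) (X : Ω → ℝ) : Set ℝ :=
  {x | 0 < μ {ω | X ω ≤ x} ∧ 0 < μ {ω | x ≤ X ω}}

/-- The stochastic kernel `K` describes the conditional distribution of `Y` given `X`: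
`ℙ(X ∈ A, Y ∈ B) = 𝔼(1_A(X) K(X, B))` for all Borel sets `A`, `B`. -/
structure IsCondKernel (μ : Measure Ω) (X Y : Ω → ℝ) (K : Kernel ℝ ℝ) : Prop where
  markov : IsMarkovKernel K
  disintegrate : ∀ A B : Set ℝ, MeasurableSet A → MeasurableSet B →
    μ (X ⁻¹' A ∩ Y ⁻¹' B) = ∫⁻ ω, A.indicator (fun x => K x B) (X ω) ∂μ

/-- `K(x₁, ·) ≤_lr K(x₂, ·)` for all `x₁ < x₂` in the range of `X`. -/
def IsLRIsotonic (μ : Measure Ω) (X : Ω → ℝ) (K : Kernel ℝ ℝ) : Prop :=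
  ∀ x₁ ∈ rangeOf μ X, ∀ x₂ ∈ rangeOf μ X, x₁ < x₂ → LikelihoodRatioLE (K x₁) (K x₂)

/-- `S(x, y) = sup_{a < x} ℙ(Y > y | a < X ≤ x)`. In Mathlib the conditional probability given an
event of probability zero is `0`. -/
noncomputable def leftSup (μ : Measure Ω) (X Y : Ω → ℝ) (x y : ℝ) : ℝ≥0∞ :=
  ⨆ a ∈ Iio x, (cond μ (X ⁻¹' Ioc a x)) (Y ⁻¹' Ioi y)

/-- `K` is the explicit kernel given by `K(x, (y, ∞)) = S(x, y)` for `x` in the range of `X`, and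
by the distribution of `Y` for all other `x`. -/
def IsExplicitKernel (μ : Measure Ω) (X Y : Ω → ℝ) (K : Kernel ℝ ℝ) : Prop :=
  (∀ x ∈ rangeOf μ X, ∀ y : ℝ, K x (Ioi y) = leftSup μ X Y x y) ∧
  (∀ x ∉ rangeOf μ X, K x = μ.map Y)

end RandomPair

end LRKernel

namespace LRKernel

open Filter Topology

/-! Everything rests on one fact about finite measures ν ≤ p on the line: if the ratios ν(I)/p(I)
increase along adjacent half-open intervals, then the supremum over a < x of ν(a, x]/p(a, x] is a
nondecreasing density dν/dp (`IntervalRatioMono.eq_withDensity_leftRatio`). Being monotone, it has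
intervals as level slices, and there ν is squeezed between multiples of p.

This fact is used twice. With p the law of X and ν its part on {Y > y}, the rectangle inequality
makes the ratios monotone, so `leftSup` is a density and the explicit kernel disintegrates (X, Y).
With ν = Q and p = P + Q, it turns a product inequality on intervals into P ≤_lr Q
(`likelihoodRatioLE_of_Ioc`). For P = K(x₁, ·) and Q = K(x₂, ·) that inequality is a limit of
rectangle inequalities, since the suprema defining K are monotone limits.

Conversely, the likelihood ratio order is a pointwise inequality between products of densities;
integrating it over y and then over the law of X, which is carried by the range, gives (i). -/

/-! ### Monotone interval ratios and their density -/

/-- The ratios `ν I / p I` over adjacent half-open intervals `I` increase from left to right. -/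
def IntervalRatioMono (ν p : Measure ℝ) : Prop :=
  ∀ a b c : ℝ, a < b → b < c → ν (Ioc a b) * p (Ioc b c) ≤ p (Ioc a b) * ν (Ioc b c)

/-- The left derivative of `ν` with respect to `p`, as the supremum of ratios over the intervals
`(a, x]`. -/
noncomputable def leftRatio (ν p : Measure ℝ) (x : ℝ) : ℝ≥0∞ :=
  ⨆ a ∈ Iio x, ν (Ioc a x) / p (Ioc a x)

theorem ENNReal.div_le_div_of_mul_le_mul {u v u' v' : ℝ≥0∞} (huv : u ≤ v) (hv : v ≠ ∞)
    (hv' : v' ≠ 0) (hv't : v' ≠ ∞) (h : u * v' ≤ v * u') : u / v ≤ u' / v' := by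
  rcases eq_or_ne v 0 with rfl | hv0
  · simp [le_zero_iff.mp huv]
  rw [ENNReal.div_le_iff hv0 hv, ← ENNReal.mul_div_right_comm, ENNReal.le_div_iff_mul_le (.inl hv')
    (.inl hv't), mul_comm u']
  exact h

theorem measure_Ioc_add_measure_Ioc (ν : Measure ℝ) {a b c : ℝ} (hab : a ≤ b) (hbc : b ≤ c) :
    ν (Ioc a c) = ν (Ioc a b) + ν (Ioc b c) := by
  rw [← Ioc_union_Ioc_eq_Ioc hab hbc, measure_union (Ioc_disjoint_Ioc_of_le le_rfl)
    measurableSet_Ioc]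

theorem measure_Icc_eq_add (ν : Measure ℝ) {a b : ℝ} (hab : a ≤ b) :
    ν (Icc a b) = ν {a} + ν (Ioc a b) := by
  rw [← Icc_union_Ioc_eq_Icc le_rfl hab, Icc_self,
    measure_union (by simp) measurableSet_Ioc]

theorem tendsto_measure_Ioc_left (ν : Measure ℝ) [IsFiniteMeasure ν] (s : ℝ) :
    Tendsto (fun n : ℕ => ν (Ioc (s - 1 / ((n : ℝ) + 1)) s)) atTop (𝓝 (ν {s})) := by
  have hs : ({s} : Set ℝ) = ⋂ n : ℕ, Ioc (s - 1 / ((n : ℝ) + 1)) s := by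
    ext x
    simp only [mem_singleton_iff, mem_iInter, mem_Ioc]
    refine ⟨?_, fun h => le_antisymm (h 0).2 ?_⟩
    · rintro rfl n
      have : 0 < 1 / ((n : ℝ) + 1) := by positivity
      exact ⟨by linarith, le_rfl⟩
    · by_contra! hx
      obtain ⟨n, hn⟩ := exists_nat_one_div_lt (sub_pos.mpr hx)
      linarith [(h n).1]
  rw [hs]
  refine tendsto_measure_iInter_atTop (fun _ => measurableSet_Ioc.nullMeasurableSet) ?_
    ⟨0, measure_ne_top _ _⟩
  intro m n hmn
  refine Ioc_subset_Ioc_left ?_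
  have := Nat.one_div_le_one_div (α := ℝ) hmn
  linarith

section

variable {ν p : Measure ℝ}

theorem leftRatio_le_one (hle : ν ≤ p) (x : ℝ) : leftRatio ν p x ≤ 1 :=
  iSup₂_le fun _ _ => ENNReal.div_le_of_le_mul (by simpa using hle _)

/-- The ratio over (a, x] is a mediant of those over (a, b] and (b, x], of which the second is
larger. -/
theorem IntervalRatioMono.ratio_mono_left (h : IntervalRatioMono ν p) {a b x : ℝ} (hab : a ≤ b)
    (hbx : b < x) : ν (Ioc a x) * p (Ioc b x) ≤ p (Ioc a x) * ν (Ioc b x) := by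
  rcases hab.eq_or_lt with rfl | hab
  · rw [mul_comm]
  rw [measure_Ioc_add_measure_Ioc ν hab.le hbx.le, measure_Ioc_add_measure_Ioc p hab.le hbx.le,
    add_mul, add_mul, mul_comm (ν (Ioc b x))]
  gcongr ?_ + _
  exact h a b x hab hbx

theorem IntervalRatioMono.leftRatio_mul_le (h : IntervalRatioMono ν p) {a b : ℝ} (hab : a ≤ b) :
    leftRatio ν p a * p (Ioc a b) ≤ ν (Ioc a b) := by
  rcases hab.eq_or_lt with rfl | hab
  · simp
  simp only [leftRatio, ENNReal.iSup_mul]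
  refine iSup₂_le fun c (hc : c < a) => ?_
  rw [← ENNReal.mul_div_right_comm]
  exact ENNReal.div_le_of_le_mul' (h c a b hc hab)

variable [IsFiniteMeasure p]

/-- For fixed a, extending (a, x] to (a, x'] adds an interval of larger ratio. -/
theorem IntervalRatioMono.leftRatio_mono (h : IntervalRatioMono ν p) (hle : ν ≤ p) :
    Monotone (leftRatio ν p) := by
  intro x x' hx
  rcases hx.eq_or_lt with rfl | hx
  · rfl
  refine iSup₂_le fun a (ha : a < x) => ?_
  refine le_trans ?_ (le_iSup₂ (f := fun a (_ : a ∈ Iio x') => ν (Ioc a x') / p (Ioc a x'))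
    a (ha.trans hx))
  rcases eq_or_ne (p (Ioc a x)) 0 with h0 | h0
  · rw [le_zero_iff.mp ((hle (Ioc a x)).trans h0.le), ENNReal.zero_div]
    exact zero_le
  refine ENNReal.div_le_div_of_mul_le_mul (hle _) (measure_ne_top _ _) ?_ (measure_ne_top _ _) ?_
  · exact fun h' => h0 (measure_mono_null (Ioc_subset_Ioc_right hx.le) h')
  · rw [measure_Ioc_add_measure_Ioc ν ha.le hx.le, measure_Ioc_add_measure_Ioc p ha.le hx.le,
      mul_add, mul_add, mul_comm (ν (Ioc a x))]
    gcongr _ + ?_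
    exact h a x x' ha hx

theorem measure_Ioc_le_leftRatio_mul (hle : ν ≤ p) {a b : ℝ} (hab : a < b) :
    ν (Ioc a b) ≤ leftRatio ν p b * p (Ioc a b) := by
  have hr : ν (Ioc a b) / p (Ioc a b) ≤ leftRatio ν p b :=
    le_iSup₂ (f := fun a (_ : a ∈ Iio b) => ν (Ioc a b) / p (Ioc a b)) a hab
  rcases eq_or_ne (p (Ioc a b)) 0 with h0 | h0
  · exact (hle _).trans (by simp [h0])
  · rwa [ENNReal.div_le_iff h0 (measure_ne_top _ _)] at hr

variable [IsFiniteMeasure ν]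

/-- The intervals (s - 1/(n+1), s] shrink to {s} and their ratios increase, so at an atom the
supremum is the ratio of the point masses. -/
theorem IntervalRatioMono.leftRatio_mul_singleton (h : IntervalRatioMono ν p) (hle : ν ≤ p)
    (s : ℝ) : leftRatio ν p s * p {s} = ν {s} := by
  have hs : ∀ n : ℕ, s - 1 / ((n : ℝ) + 1) < s := fun n => by
    have : 0 < 1 / ((n : ℝ) + 1) := by positivity
    linarith
  have hν := tendsto_measure_Ioc_left ν s
  have hp := tendsto_measure_Ioc_left p s
  apply le_antisymm
  · simp only [leftRatio, ENNReal.iSup_mul]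
    refine iSup₂_le fun a (ha : a < s) => ?_
    rw [← ENNReal.mul_div_right_comm]
    refine ENNReal.div_le_of_le_mul' ?_
    refine le_of_tendsto_of_tendsto
      (ENNReal.Tendsto.const_mul hp (.inr (measure_ne_top ν (Ioc a s))))
      (ENNReal.Tendsto.const_mul hν (.inr (measure_ne_top p (Ioc a s)))) ?_
    obtain ⟨N, hN⟩ := exists_nat_one_div_lt (sub_pos.mpr ha)
    filter_upwards [eventually_ge_atTop N] with n hn
    have := Nat.one_div_le_one_div (α := ℝ) hn
    exact h.ratio_mono_left (by linarith) (hs n)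
  · refine le_of_tendsto_of_tendsto' hν (ENNReal.Tendsto.const_mul hp (.inr ?_))
      fun n => measure_Ioc_le_leftRatio_mul hle (hs n)
    exact ((leftRatio_le_one hle s).trans_lt ENNReal.one_lt_top).ne

theorem IntervalRatioMono.measure_Icc_le (h : IntervalRatioMono ν p) (hle : ν ≤ p) {a b : ℝ}
    (hab : a ≤ b) : ν (Icc a b) ≤ leftRatio ν p b * p (Icc a b) := by
  rw [measure_Icc_eq_add _ hab, measure_Icc_eq_add _ hab, mul_add,
    ← h.leftRatio_mul_singleton hle]
  gcongr
  · exact h.leftRatio_mono hle hab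
  · rcases hab.eq_or_lt with rfl | hab
    · simp
    · exact measure_Ioc_le_leftRatio_mul hle hab

theorem IntervalRatioMono.le_measure_Icc (h : IntervalRatioMono ν p) (hle : ν ≤ p) {a b : ℝ}
    (hab : a ≤ b) : leftRatio ν p a * p (Icc a b) ≤ ν (Icc a b) := by
  rw [measure_Icc_eq_add _ hab, measure_Icc_eq_add _ hab, mul_add,
    ← h.leftRatio_mul_singleton hle]
  gcongr
  exact h.leftRatio_mul_le hab

theorem _root_.IsCompact.exists_subset_Icc {C : Set ℝ} (hC : IsCompact C) (hne : C.Nonempty) :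
    ∃ a ∈ C, ∃ b ∈ C, a ≤ b ∧ C ⊆ Icc a b := by
  obtain ⟨a, ha, ha'⟩ := hC.exists_isLeast hne
  obtain ⟨b, hb, hb'⟩ := hC.exists_isGreatest hne
  exact ⟨a, ha, b, hb, ha' hb, fun x hx => ⟨ha' hx, hb' hx⟩⟩

/-- Inner regularity reduces A, whose ends may be open or closed, to a compact C, and
order-connectedness keeps the hull [min C, max C] inside A. -/
theorem IntervalRatioMono.measure_le_of_ordConnected (h : IntervalRatioMono ν p) (hle : ν ≤ p)
    {A : Set ℝ} (hA : A.OrdConnected) (hAm : MeasurableSet A) {c : ℝ≥0∞}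
    (hc : ∀ x ∈ A, leftRatio ν p x ≤ c) : ν A ≤ c * p A := by
  rw [hAm.measure_eq_iSup_isCompact]
  refine iSup₂_le fun C hCA => iSup_le fun hC => ?_
  rcases C.eq_empty_or_nonempty with rfl | hne
  · simp
  obtain ⟨a, ha, b, hb, hab, hCab⟩ := hC.exists_subset_Icc hne
  calc ν C ≤ ν (Icc a b) := measure_mono hCab
    _ ≤ leftRatio ν p b * p (Icc a b) := h.measure_Icc_le hle hab
    _ ≤ c * p A := by
      gcongr
      · exact hc b (hCA hb)
      · exact hA.out (hCA ha) (hCA hb)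

theorem IntervalRatioMono.le_measure_of_ordConnected (h : IntervalRatioMono ν p) (hle : ν ≤ p)
    {A : Set ℝ} (hA : A.OrdConnected) (hAm : MeasurableSet A) {c : ℝ≥0∞}
    (hc : ∀ x ∈ A, c ≤ leftRatio ν p x) : c * p A ≤ ν A := by
  rw [hAm.measure_eq_iSup_isCompact p]
  simp only [ENNReal.mul_iSup]
  refine iSup₂_le fun C hCA => iSup_le fun hC => ?_
  rcases C.eq_empty_or_nonempty with rfl | hne
  · simp
  obtain ⟨a, ha, b, hb, hab, hCab⟩ := hC.exists_subset_Icc hne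
  calc c * p C ≤ leftRatio ν p a * p (Icc a b) := by
        gcongr
        exact hc a (hCA ha)
    _ ≤ ν (Icc a b) := h.le_measure_Icc hle hab
    _ ≤ ν A := measure_mono (hA.out (hCA ha) (hCA hb))

/-- On an order-connected set where the left ratio varies by at most `ε`, the measure `ν` and the
integral of the left ratio differ by at most `ε * p A`. -/
theorem IntervalRatioMono.measure_near_setLIntegral (h : IntervalRatioMono ν p) (hle : ν ≤ p)
    {A : Set ℝ} (hA : A.OrdConnected) (hAm : MeasurableSet A) {c ε : ℝ≥0∞}
    (hc : ∀ x ∈ A, c ≤ leftRatio ν p x) (hc' : ∀ x ∈ A, leftRatio ν p x ≤ c + ε) :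
    ν A ≤ ∫⁻ x in A, leftRatio ν p x ∂p + ε * p A ∧
      ∫⁻ x in A, leftRatio ν p x ∂p ≤ ν A + ε * p A := by
  have h1 : c * p A ≤ ∫⁻ x in A, leftRatio ν p x ∂p := by
    rw [← setLIntegral_const]
    exact setLIntegral_mono (h.leftRatio_mono hle).measurable hc
  have h2 : ∫⁻ x in A, leftRatio ν p x ∂p ≤ (c + ε) * p A := by
    rw [← setLIntegral_const]
    exact setLIntegral_mono measurable_const hc'
  have h3 := h.measure_le_of_ordConnected hle hA hAm hc'
  have h4 := h.le_measure_of_ordConnected hle hA hAm hc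
  rw [add_mul] at h2 h3
  exact ⟨h3.trans (by gcongr), h2.trans (by gcongr)⟩

/-- The half-line is cut into the slices where the left ratio lies in [i/n, (i+1)/n). They are
order-connected by monotonicity, and the errors p(A i)/n add up to p(Iic b)/n. -/
theorem IntervalRatioMono.measure_near_setLIntegral_Iic (h : IntervalRatioMono ν p) (hle : ν ≤ p)
    (b : ℝ) {n : ℕ} (hn : n ≠ 0) :
    ν (Iic b) ≤ ∫⁻ x in Iic b, leftRatio ν p x ∂p + (n : ℝ≥0∞)⁻¹ * p (Iic b) ∧
      ∫⁻ x in Iic b, leftRatio ν p x ∂p ≤ ν (Iic b) + (n : ℝ≥0∞)⁻¹ * p (Iic b) := by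
  have hmono := h.leftRatio_mono hle
  have hfin : ∀ x, leftRatio ν p x ≠ ∞ := fun x =>
    ((leftRatio_le_one hle x).trans_lt ENNReal.one_lt_top).ne
  let j : ℝ → ℕ := fun x => ⌊(n : ℝ) * (leftRatio ν p x).toReal⌋₊
  have hj : Monotone j := fun x y hxy => Nat.floor_le_floor (by
    gcongr
    · exact hfin y
    · exact hmono hxy)
  let A : ℕ → Set ℝ := fun i => Iic b ∩ j ⁻¹' {i}
  have hA : ∀ i, (A i).OrdConnected := fun i =>
    ordConnected_Iic.inter ((ordConnected_singleton (a := i)).preimage_mono hj)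
  have hAm : ∀ i, MeasurableSet (A i) := fun i => (hA i).measurableSet
  have hAd : Pairwise (Function.onFun Disjoint A) := fun i k hik =>
    disjoint_left.mpr fun x hx hx' => hik (hx.2.symm.trans hx'.2)
  have hAU : Iic b = ⋃ i, A i := by
    ext x
    simp [A]
  have hn' : (0 : ℝ) < n := by positivity
  have hnear := fun i => h.measure_near_setLIntegral hle (hA i) (hAm i)
    (c := (i : ℝ≥0∞) / n) (ε := (n : ℝ≥0∞)⁻¹) (fun x hx => by
      have hx2 : j x = i := hx.2
      rw [← hx2, ENNReal.div_le_iff (by simpa) (by simp), ← ENNReal.ofReal_toReal (hfin x),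
        ← ENNReal.ofReal_natCast, ← ENNReal.ofReal_natCast n, ← ENNReal.ofReal_mul (by simp)]
      refine ENNReal.ofReal_le_ofReal ?_
      rw [mul_comm]
      exact Nat.floor_le (by positivity)) (fun x hx => by
      have hx2 : j x = i := hx.2
      rw [← hx2, ← one_div, ← ENNReal.add_div, ENNReal.le_div_iff_mul_le (.inl (by simpa))
        (.inl (by simp)), ← ENNReal.ofReal_toReal (hfin x), ← Nat.cast_add_one,
        ← ENNReal.ofReal_natCast n, ← ENNReal.ofReal_natCast (j x + 1),
        ← ENNReal.ofReal_mul (by simp)]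
      refine ENNReal.ofReal_le_ofReal ?_
      rw [mul_comm]
      push_cast
      exact (Nat.lt_floor_add_one _).le)
  rw [hAU, lintegral_iUnion hAm hAd, measure_iUnion hAd hAm, measure_iUnion hAd hAm,
    ← ENNReal.tsum_mul_left, ← ENNReal.tsum_add, ← ENNReal.tsum_add]
  exact ⟨ENNReal.tsum_le_tsum fun i => (hnear i).1, ENNReal.tsum_le_tsum fun i => (hnear i).2⟩

/-- If the interval ratios of `ν ≤ p` are monotone, then the left ratio is a density of `ν` with
respect to `p`. -/
theorem IntervalRatioMono.eq_withDensity_leftRatio (h : IntervalRatioMono ν p) (hle : ν ≤ p) :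
    ν = p.withDensity (leftRatio ν p) := by
  refine Measure.ext_of_Iic _ _ fun b => ?_
  rw [withDensity_apply _ measurableSet_Iic]
  have hlim : Tendsto (fun n : ℕ => ((n : ℝ≥0∞)⁻¹ * p (Iic b))) atTop (𝓝 0) := by
    simpa using ENNReal.Tendsto.mul_const ENNReal.tendsto_inv_nat_nhds_zero
      (.inr (measure_ne_top p (Iic b)))
  have hadd : ∀ c : ℝ≥0∞, Tendsto (fun n : ℕ => c + ((n : ℝ≥0∞)⁻¹ * p (Iic b))) atTop (𝓝 c) :=
    fun c => by simpa using hlim.const_add c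
  apply le_antisymm
  · refine ge_of_tendsto (hadd _) ?_
    filter_upwards [eventually_ne_atTop 0] with n hn
    exact (h.measure_near_setLIntegral_Iic hle b hn).1
  · refine ge_of_tendsto (hadd _) ?_
    filter_upwards [eventually_ne_atTop 0] with n hn
    exact (h.measure_near_setLIntegral_Iic hle b hn).2

end

/-! ### The likelihood ratio order and product inequalities -/

theorem lintegral_mul_lintegral_mono {α β : Type*} [MeasurableSpace α] [MeasurableSpace β]
    {m : Measure α} {n : Measure β} {u u' : α → ℝ≥0∞} {v v' : β → ℝ≥0∞} (hu : Measurable u)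
    (hu' : Measurable u') (hv : Measurable v) (hv' : Measurable v')
    (h : ∀ᵐ s ∂m, ∀ᵐ t ∂n, u s * v t ≤ u' s * v' t) :
    (∫⁻ s, u s ∂m) * ∫⁻ t, v t ∂n ≤ (∫⁻ s, u' s ∂m) * ∫⁻ t, v' t ∂n := by
  rw [← lintegral_mul_const _ hu, ← lintegral_mul_const _ hu']
  refine lintegral_mono_ae ?_
  filter_upwards [h] with s hs
  rw [← lintegral_const_mul _ hv, ← lintegral_const_mul _ hv']
  exact lintegral_mono_ae hs

theorem LikelihoodRatioLE.refl (P : Measure ℝ) [SigmaFinite P] : LikelihoodRatioLE P P :=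
  ⟨P, 1, 1, inferInstance, measurable_const, measurable_const, by simp, by simp,
    fun _ _ _ _ _ => le_rfl⟩

theorem mul_le_mul_of_ratio_monotoneOn {f g : ℝ → ℝ≥0}
    (h : MonotoneOn (fun y => (g y : ℝ≥0∞) / (f y : ℝ≥0∞)) {y | 0 < f y + g y}) {s t : ℝ}
    (hst : s < t) : (g s : ℝ≥0∞) * f t ≤ f s * g t := by
  rcases eq_or_ne (f t) 0 with ht | ht
  · simp [ht]
  rcases eq_or_ne (g s) 0 with hs | hs
  · simp [hs]
  have hr : (g s : ℝ≥0∞) / f s ≤ g t / f t :=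
    h (add_pos_of_nonneg_of_pos zero_le (pos_iff_ne_zero.mpr hs))
      (add_pos_of_pos_of_nonneg (pos_iff_ne_zero.mpr ht) zero_le) hst.le
  rw [ENNReal.le_div_iff_mul_le (.inl (by simpa)) (.inl (by simp)),
    ← ENNReal.mul_div_right_comm] at hr
  -- If f s = 0 < g s, the ratio is ∞ at s but finite at t, against monotonicity.
  rcases eq_or_ne (f s) 0 with hs' | hs'
  · rw [hs', ENNReal.coe_zero, ENNReal.div_zero (by simp [hs, ht])] at hr
    simp at hr
  · rwa [ENNReal.div_le_iff (by simpa) (by simp), mul_comm (g t : ℝ≥0∞)] at hr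

theorem LikelihoodRatioLE.measure_mul_le {P Q : Measure ℝ} (h : LikelihoodRatioLE P Q)
    {B₁ B₂ : Set ℝ} (hB₁ : MeasurableSet B₁) (hB₂ : MeasurableSet B₂) (hB : SetLT B₁ B₂) :
    P B₂ * Q B₁ ≤ P B₁ * Q B₂ := by
  obtain ⟨m, f, g, _, hf, hg, rfl, rfl, hmono⟩ := h
  simp only [withDensity_apply _ hB₁, withDensity_apply _ hB₂]
  rw [mul_comm]
  refine lintegral_mul_lintegral_mono (by fun_prop) (by fun_prop) (by fun_prop) (by fun_prop) ?_
  filter_upwards [ae_restrict_mem hB₁] with s hs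
  filter_upwards [ae_restrict_mem hB₂] with t ht
  exact mul_le_mul_of_ratio_monotoneOn hmono (hB s hs t ht)

/-- The likelihood ratio order follows from the product inequality on adjacent intervals. -/
theorem likelihoodRatioLE_of_Ioc {P Q : Measure ℝ} [IsFiniteMeasure P] [IsFiniteMeasure Q]
    (h : ∀ a b c : ℝ, a < b → b < c → P (Ioc b c) * Q (Ioc a b) ≤ P (Ioc a b) * Q (Ioc b c)) :
    LikelihoodRatioLE P Q := by
  have hle : Q ≤ P + Q := Measure.le_add_left le_rfl
  have hmono : IntervalRatioMono Q (P + Q) := by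
    intro a b c hab hbc
    simp only [Measure.coe_add, Pi.add_apply, mul_add, add_mul]
    -- The products of two Q-masses agree on both sides and drop out.
    gcongr ?_ + _
    rw [mul_comm]
    exact h a b c hab hbc
  set k := leftRatio Q (P + Q)
  have hk1 : ∀ x, k x ≤ 1 := leftRatio_le_one hle
  have hkt : ∀ x, k x ≠ ∞ := fun x => ((hk1 x).trans_lt ENNReal.one_lt_top).ne
  have hk : Monotone k := hmono.leftRatio_mono hle
  have hkm : Measurable k := hk.measurable
  have hQ : Q = (P + Q).withDensity k := hmono.eq_withDensity_leftRatio hle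
  have hP : P = (P + Q).withDensity (fun x => 1 - k x) := by
    have hsum : (P + Q).withDensity (fun x => 1 - k x) + (P + Q).withDensity k = P + Q := by
      rw [← withDensity_add_right _ hkm]
      have : ((fun x => 1 - k x) + k) = 1 := by
        ext x
        exact tsub_add_cancel_of_le (hk1 x)
      rw [this, withDensity_one]
    rw [← hQ] at hsum
    exact ((Measure.add_left_inj _ _ _).mp hsum).symm
  refine ⟨P + Q, fun x => (1 - k x).toNNReal, fun x => (k x).toNNReal, inferInstance,
    by fun_prop, by fun_prop, ?_, ?_, ?_⟩
  · simpa [ENNReal.coe_toNNReal, hkt] using hP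
  · simpa [ENNReal.coe_toNNReal, hkt] using hQ
  · intro x _ y _ hxy
    simp only [ENNReal.coe_toNNReal (hkt _),
      ENNReal.coe_toNNReal (ENNReal.sub_ne_top ENNReal.one_ne_top)]
    exact ENNReal.div_le_div (hk hxy) (tsub_le_tsub_left (hk hxy) 1)

/-! ### Left ratios as limits, and gaps of p -/

section

variable {ν p : Measure ℝ} [IsFiniteMeasure p]

/-- Limits, unlike suprema, pass through differences and products. Indices with p(a, x] = 0 are
excluded because there 0/0 = 0 would break monotonicity in a. -/
theorem IntervalRatioMono.tendsto_leftRatio (h : IntervalRatioMono ν p) (hle : ν ≤ p) (x : ℝ) :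
    Tendsto (fun a : {a // a < x ∧ p (Ioc a x) ≠ 0} => ν (Ioc a x) / p (Ioc a x)) atTop
      (𝓝 (leftRatio ν p x)) := by
  have hsup : leftRatio ν p x =
      ⨆ a : {a // a < x ∧ p (Ioc a x) ≠ 0}, ν (Ioc a x) / p (Ioc a x) := by
    apply le_antisymm
    · refine iSup₂_le fun a ha => ?_
      rcases eq_or_ne (p (Ioc a x)) 0 with h0 | h0
      · rw [le_zero_iff.mp ((hle (Ioc a x)).trans h0.le), ENNReal.zero_div]
        exact zero_le
      · exact le_iSup (fun a : {a // a < x ∧ p (Ioc a x) ≠ 0} => ν (Ioc a x) / p (Ioc a x))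
          ⟨a, ha, h0⟩
    · exact iSup_le fun a =>
        le_iSup₂ (f := fun a (_ : a ∈ Iio x) => ν (Ioc a x) / p (Ioc a x)) a.1 a.2.1
  rw [hsup]
  refine tendsto_atTop_iSup fun a b hab => ?_
  exact ENNReal.div_le_div_of_mul_le_mul (hle _) (measure_ne_top _ _) b.2.2 (measure_ne_top _ _)
    (h.ratio_mono_left hab b.2.1)

theorem IntervalRatioMono.leftRatio_eq_of_null (h : IntervalRatioMono ν p) (hle : ν ≤ p)
    {x₁ x₂ : ℝ} (hx : x₁ < x₂) (h0 : p (Ioc x₁ x₂) = 0) :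
    leftRatio ν p x₁ = leftRatio ν p x₂ := by
  refine le_antisymm (h.leftRatio_mono hle hx.le) (iSup₂_le fun a _ => ?_)
  have hν0 : ν (Ioc x₁ x₂) = 0 := le_zero_iff.mp ((hle _).trans h0.le)
  rcases lt_or_ge a x₁ with ha' | ha'
  · rw [measure_Ioc_add_measure_Ioc ν ha'.le hx.le, measure_Ioc_add_measure_Ioc p ha'.le hx.le,
      hν0, h0, add_zero, add_zero]
    exact le_iSup₂ (f := fun a (_ : a ∈ Iio x₁) => ν (Ioc a x₁) / p (Ioc a x₁)) a ha'
  · rw [measure_mono_null (Ioc_subset_Ioc_left ha') hν0, ENNReal.zero_div]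
    exact zero_le

end

/-! ### Half-lines and survival functions -/

theorem tendsto_measure_Ioc_atTop (p : Measure ℝ) (a : ℝ) :
    Tendsto (fun t => p (Ioc a t)) atTop (𝓝 (p (Ioi a))) := by
  rw [← iUnion_Ioc_right]
  exact tendsto_measure_iUnion_atTop fun s t hst => Ioc_subset_Ioc_right hst

theorem tendsto_measure_Ioi_atBot (p : Measure ℝ) :
    Tendsto (fun t => p (Ioi t)) atBot (𝓝 (p univ)) := by
  refine tendsto_of_tendsto_of_tendsto_of_le_of_le
    ((tendsto_measure_Ici_atBot p).comp (tendsto_atBot_add_const_right atBot (1 : ℝ) tendsto_id))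
    tendsto_const_nhds (fun t => ?_) (fun t => measure_mono (subset_univ _))
  exact measure_mono fun x hx => lt_of_lt_of_le (lt_add_one t) hx

theorem tendsto_measure_Ioi_atTop (p : Measure ℝ) [IsFiniteMeasure p] :
    Tendsto (fun t => p (Ioi t)) atTop (𝓝 0) := by
  have h : ∀ t, p (Ioi t) = p univ - p (Iic t) := fun t => by
    rw [← compl_Iic, measure_compl measurableSet_Iic (measure_ne_top _ _)]
  simp only [h]
  simpa using ENNReal.Tendsto.sub tendsto_const_nhds (tendsto_measure_Iic_atTop p)
    (.inl (measure_ne_top p univ))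

/-- A compact subset of (y, ∞) has a minimum above y, so it stays inside (z, ∞) for z near y. Lower
semicontinuity survives the supremum in `leftSup`. -/
theorem lowerSemicontinuous_measure_Ioi (p : Measure ℝ) [IsFiniteMeasure p] :
    LowerSemicontinuous fun y => p (Ioi y) := by
  intro y c hc
  obtain ⟨C, hCy, hC, hcC⟩ := measurableSet_Ioi.exists_lt_isCompact hc
  rcases C.eq_empty_or_nonempty with rfl | hne
  · simp at hcC
  obtain ⟨a, ha, b, -, -, hCab⟩ := hC.exists_subset_Icc hne
  filter_upwards [Iio_mem_nhds (hCy ha)] with z hz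
  exact hcC.trans_le (measure_mono fun x hx => lt_of_lt_of_le hz (hCab hx).1)

/-- The exceptional set is a lower set; a compact subset lies below its own maximum b, and (-∞, b]
is null. -/
theorem ae_measure_Iic_ne_zero (p : Measure ℝ) [IsFiniteMeasure p] : ∀ᵐ x ∂p, p (Iic x) ≠ 0 := by
  have hS : IsLowerSet {x | p (Iic x) = 0} := fun x y hyx hx =>
    measure_mono_null (Iic_subset_Iic.mpr hyx) hx
  rw [ae_iff]
  simp only [not_not]
  rw [hS.ordConnected.measurableSet.measure_eq_iSup_isCompact, ← le_zero_iff]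
  refine iSup₂_le fun C hCS => iSup_le fun hC => ?_
  rcases C.eq_empty_or_nonempty with rfl | hne
  · simp
  obtain ⟨a, -, b, hb, -, hCab⟩ := hC.exists_subset_Icc hne
  exact (measure_mono_null (fun x hx => (hCab hx).2) (hCS hb)).le

theorem ae_measure_Ici_ne_zero (p : Measure ℝ) [IsFiniteMeasure p] : ∀ᵐ x ∂p, p (Ici x) ≠ 0 := by
  have hS : IsUpperSet {x | p (Ici x) = 0} := fun x y hyx hx =>
    measure_mono_null (Ici_subset_Ici.mpr hyx) hx
  rw [ae_iff]
  simp only [not_not]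
  rw [hS.ordConnected.measurableSet.measure_eq_iSup_isCompact, ← le_zero_iff]
  refine iSup₂_le fun C hCS => iSup_le fun hC => ?_
  rcases C.eq_empty_or_nonempty with rfl | hne
  · simp
  obtain ⟨a, ha, b, -, -, hCab⟩ := hC.exists_subset_Icc hne
  exact (measure_mono_null (fun x hx => (hCab hx).1) (hCS ha)).le

/-- A lower semicontinuous survival function is the survival function of a probability measure. -/
theorem exists_isProbabilityMeasure_Ioi {S : ℝ → ℝ≥0∞} (hS : Antitone S)
    (hlsc : LowerSemicontinuous S) (hbot : Tendsto S atBot (𝓝 1)) (htop : Tendsto S atTop (𝓝 0)) :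
    ∃ P : Measure ℝ, IsProbabilityMeasure P ∧ ∀ y, P (Ioi y) = S y := by
  have hS1 : ∀ y, S y ≤ 1 := fun y => ge_of_tendsto hbot <| by
    filter_upwards [eventually_le_atBot y] with z hz using hS hz
  have hSt : ∀ y, S y ≠ ∞ := fun y => ((hS1 y).trans_lt ENNReal.one_lt_top).ne
  -- For an antitone function, lower semicontinuity is right-continuity.
  have hright : ∀ y, ContinuousWithinAt S (Ici y) y := by
    intro y
    refine tendsto_order.mpr ⟨fun c hc => (hlsc y c hc).filter_mono nhdsWithin_le_nhds,
      fun c hc => ?_⟩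
    filter_upwards [self_mem_nhdsWithin] with z hz using (hS hz).trans_lt hc
  let F : StieltjesFunction ℝ :=
    { toFun := fun y => 1 - (S y).toReal
      mono' := fun y z hyz => sub_le_sub_left (ENNReal.toReal_mono (hSt y) (hS hyz)) 1
      right_continuous' := fun y =>
        ((ENNReal.tendsto_toReal (hSt y)).comp (hright y)).const_sub 1 }
  have hF0 : Tendsto F atBot (𝓝 0) := by
    simpa using ((ENNReal.tendsto_toReal ENNReal.one_ne_top).comp hbot).const_sub 1
  have hF1 : Tendsto F atTop (𝓝 1) := by
    simpa using ((ENNReal.tendsto_toReal ENNReal.zero_ne_top).comp htop).const_sub 1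
  refine ⟨F.measure, F.isProbabilityMeasure hF0 hF1, fun y => ?_⟩
  rw [F.measure_Ioi hF1]
  change ENNReal.ofReal (1 - (1 - (S y).toReal)) = S y
  rw [sub_sub_cancel, ENNReal.ofReal_toReal (hSt y)]

/-! ### From rectangles to the explicit kernel -/

section

variable {Ω : Type*} [MeasurableSpace Ω] {μ : Measure Ω} {X Y : Ω → ℝ}

/-- The TP2 inequality for all adjacent half-open rectangles. -/
def RectangleTP2 (μ : Measure Ω) (X Y : Ω → ℝ) : Prop :=
  ∀ x₀ x₁ x₂ y₀ y₁ y₂ : ℝ, x₀ < x₁ → x₁ < x₂ → y₀ < y₁ → y₁ < y₂ →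
    TP2Ineq μ X Y (Ioc x₀ x₁) (Ioc x₁ x₂) (Ioc y₀ y₁) (Ioc y₁ y₂)

/-- The sub-law of `X` on the event `Y ∈ B`. -/
noncomputable def subLaw (μ : Measure Ω) (X Y : Ω → ℝ) (B : Set ℝ) : Measure ℝ :=
  (μ.restrict (Y ⁻¹' B)).map X

instance [IsFiniteMeasure μ] (B : Set ℝ) : IsFiniteMeasure (subLaw μ X Y B) := by
  unfold subLaw
  infer_instance

theorem subLaw_apply (hX : Measurable X) (B : Set ℝ) {A : Set ℝ} (hA : MeasurableSet A) :
    subLaw μ X Y B A = μ (X ⁻¹' A ∩ Y ⁻¹' B) := by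
  rw [subLaw, Measure.map_apply hX hA, Measure.restrict_apply (hX hA)]

theorem subLaw_le (hX : Measurable X) (B : Set ℝ) : subLaw μ X Y B ≤ μ.map X :=
  Measure.map_mono Measure.restrict_le_self hX

theorem subLaw_apply_eq_map_restrict (hX : Measurable X) (hY : Measurable Y) {A B : Set ℝ}
    (hA : MeasurableSet A) (hB : MeasurableSet B) :
    subLaw μ X Y B A = (μ.restrict (X ⁻¹' A)).map Y B := by
  rw [subLaw_apply hX B hA, Measure.map_apply hY hB, Measure.restrict_apply (hY hB), inter_comm]

theorem leftSup_eq_leftRatio (hX : Measurable X) (x y : ℝ) :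
    leftSup μ X Y x y = leftRatio (subLaw μ X Y (Ioi y)) (μ.map X) x := by
  simp only [leftSup, leftRatio, cond_apply (hX measurableSet_Ioc),
    subLaw_apply hX _ measurableSet_Ioc, Measure.map_apply hX measurableSet_Ioc,
    ENNReal.div_eq_inv_mul]

theorem mem_rangeOf_iff (hX : Measurable X) (x : ℝ) :
    x ∈ rangeOf μ X ↔ μ.map X (Iic x) ≠ 0 ∧ μ.map X (Ici x) ≠ 0 := by
  rw [Measure.map_apply hX measurableSet_Iic, Measure.map_apply hX measurableSet_Ici]
  simp only [rangeOf, mem_ofPred_eq, pos_iff_ne_zero]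
  rfl

theorem measurableSet_rangeOf (X : Ω → ℝ) : MeasurableSet (rangeOf μ X) := by
  refine OrdConnected.measurableSet ⟨fun x hx z hz y hy => ⟨?_, ?_⟩⟩
  · exact hx.1.trans_le (measure_mono fun ω (hω : X ω ≤ x) => hω.trans hy.1)
  · exact hz.2.trans_le (measure_mono fun ω (hω : z ≤ X ω) => hy.2.trans hω)

theorem subLaw_apply_le (hX : Measurable X) (hY : Measurable Y) {A B : Set ℝ}
    (hA : MeasurableSet A) (hB : MeasurableSet B) : subLaw μ X Y B A ≤ μ.map Y B := by
  rw [subLaw_apply hX _ hA, Measure.map_apply hY hB]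
  exact measure_mono inter_subset_right

theorem lintegral_indicator_comp_eq (hX : Measurable X) (K : Kernel ℝ ℝ) {A B : Set ℝ}
    (hA : MeasurableSet A) (hB : MeasurableSet B) :
    ∫⁻ ω, A.indicator (fun x => K x B) (X ω) ∂μ = ∫⁻ x in A, K x B ∂μ.map X := by
  rw [← lintegral_indicator hA, lintegral_map ((K.measurable_coe hB).indicator hA) hX]

theorem exists_measure_Ioc_ne_zero (hX : Measurable X) {x : ℝ} (hx : x ∈ rangeOf μ X) :
    ∃ a < x, μ.map X (Ioc a x) ≠ 0 := by
  have := (tendsto_measure_Ioc_atBot (μ.map X) x).eventually_ne ((mem_rangeOf_iff hX x).mp hx).1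
  obtain ⟨a, ha, hax⟩ := (this.and (eventually_lt_atBot x)).exists
  exact ⟨a, hax, ha⟩

variable [IsFiniteMeasure μ]

/-- Splitting the law of X at Y ≤ y and Y > y leaves a common product on both sides; the rest is the
limit t → ∞ of the rectangle inequality for (y - t, y] and (y, y + t]. -/
theorem RectangleTP2.intervalRatioMono (h : RectangleTP2 μ X Y) (hX : Measurable X)
    (hY : Measurable Y) (y : ℝ) : IntervalRatioMono (subLaw μ X Y (Ioi y)) (μ.map X) := by
  have hsplit : μ.map X = subLaw μ X Y (Iic y) + subLaw μ X Y (Ioi y) := by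
    rw [subLaw, subLaw, ← Measure.map_add _ _ hX, ← compl_Iic, preimage_compl,
      Measure.restrict_add_restrict_compl (hY measurableSet_Iic)]
  intro a b c hab hbc
  simp only [hsplit, Measure.coe_add, Pi.add_apply, mul_add, add_mul]
  gcongr ?_ + _
  simp only [subLaw_apply_eq_map_restrict hX hY measurableSet_Ioc measurableSet_Ioi,
    subLaw_apply_eq_map_restrict hX hY measurableSet_Ioc measurableSet_Iic]
  set m₁ := (μ.restrict (X ⁻¹' Ioc a b)).map Y
  set m₂ := (μ.restrict (X ⁻¹' Ioc b c)).map Y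
  have hup : ∀ m : Measure ℝ, Tendsto (fun t => m (Ioc y (y + t))) atTop (𝓝 (m (Ioi y))) :=
    fun m => (tendsto_measure_Ioc_atTop m y).comp (tendsto_atTop_add_const_left _ y tendsto_id)
  have hdn : ∀ m : Measure ℝ, Tendsto (fun t => m (Ioc (y - t) y)) atTop (𝓝 (m (Iic y))) :=
    fun m => (tendsto_measure_Ioc_atBot m y).comp
      ((tendsto_atBot_add_const_left atTop y tendsto_neg_atTop_atBot).congr fun t =>
        (sub_eq_add_neg y t).symm)
  refine le_of_tendsto_of_tendsto
    (ENNReal.Tendsto.mul (hup m₁) (.inr (measure_ne_top _ _)) (hdn m₂) (.inr (measure_ne_top _ _)))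
    (ENNReal.Tendsto.mul (hdn m₁) (.inr (measure_ne_top _ _)) (hup m₂) (.inr (measure_ne_top _ _)))
    ?_
  filter_upwards [eventually_gt_atTop 0] with t ht
  have := h a b c (y - t) y (y + t) hab hbc (by linarith) (by linarith)
  simpa only [TP2Ineq, ← subLaw_apply hX _ measurableSet_Ioc,
    subLaw_apply_eq_map_restrict hX hY measurableSet_Ioc measurableSet_Ioc] using this

/-- Transitivity of the order of slopes of the pairs (a₁, a₂), (g₁, g₂), (c₁, c₂). It would fail
through (0, 0), hence `hg`. -/
theorem ENNReal.mul_le_mul_trans {a₁ a₂ g₁ g₂ c₁ c₂ : ℝ≥0∞} (hg₁ : g₁ ≠ ∞)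
    (hg : g₁ ≠ 0 ∨ g₂ ≠ 0) (hag : a₂ * g₁ ≤ a₁ * g₂) (hgc : g₂ * c₁ ≤ g₁ * c₂) :
    a₂ * c₁ ≤ a₁ * c₂ := by
  rcases eq_or_ne g₁ 0 with h0 | h0
  · rw [h0, zero_mul, le_zero_iff, mul_eq_zero] at hgc
    have : c₁ = 0 := hgc.resolve_left (hg.resolve_left (not_not.mpr h0))
    simp [this]
  · rw [← ENNReal.mul_le_mul_iff_right h0 hg₁]
    calc g₁ * (a₂ * c₁) = (a₂ * g₁) * c₁ := by ring
      _ ≤ (a₁ * g₂) * c₁ := by gcongr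
      _ = a₁ * (g₂ * c₁) := by ring
      _ ≤ a₁ * (g₁ * c₂) := by gcongr
      _ = g₁ * (a₁ * c₂) := by ring

/-- TP2 on rectangles whose first sides need not be adjacent. -/
theorem RectangleTP2.of_le (h : RectangleTP2 μ X Y) (hX : Measurable X) {a₁ x₁ a₂ x₂ y₀ y₁ y₂ : ℝ}
    (h₁ : a₁ < x₁) (h₁₂ : x₁ ≤ a₂) (h₂ : a₂ < x₂) (hy₁ : y₀ < y₁) (hy₂ : y₁ < y₂) :
    TP2Ineq μ X Y (Ioc a₁ x₁) (Ioc a₂ x₂) (Ioc y₀ y₁) (Ioc y₁ y₂) := by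
  rcases h₁₂.eq_or_lt with rfl | h₁₂
  · exact h _ _ _ _ _ _ h₁ h₂ hy₁ hy₂
  by_cases hg : μ (X ⁻¹' Ioc x₁ a₂ ∩ Y ⁻¹' Ioc y₀ y₁) ≠ 0 ∨
      μ (X ⁻¹' Ioc x₁ a₂ ∩ Y ⁻¹' Ioc y₁ y₂) ≠ 0
  · exact ENNReal.mul_le_mul_trans (measure_ne_top _ _) hg
      (h _ _ _ _ _ _ h₁ h₁₂ hy₁ hy₂) (h _ _ _ _ _ _ h₁₂ h₂ hy₁ hy₂)
  -- A gap without mass can be absorbed: (x₁, x₂] and (a₂, x₂] then carry the same rectangle masses.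
  · push Not at hg
    have := h _ _ _ _ _ _ h₁ (h₁₂.trans h₂) hy₁ hy₂
    simp only [TP2Ineq, ← subLaw_apply hX _ measurableSet_Ioc] at this hg ⊢
    simpa only [measure_Ioc_add_measure_Ioc _ h₁₂.le h₂.le, hg.1, hg.2, zero_add] using this

theorem ae_mem_rangeOf (hX : Measurable X) : ∀ᵐ x ∂μ.map X, x ∈ rangeOf μ X := by
  filter_upwards [ae_measure_Iic_ne_zero (μ.map X), ae_measure_Ici_ne_zero (μ.map X)] with x h₁ h₂
  exact (mem_rangeOf_iff hX x).mpr ⟨h₁, h₂⟩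

/-- This keeps mass from escaping to +∞: d does not depend on y, so `leftSup` decays with the tail
of Y. An interval to the right of x has at least the left ratio; if X has no mass there, x is an
atom and serves instead. -/
theorem RectangleTP2.exists_leftSup_mul_le (h : RectangleTP2 μ X Y) (hX : Measurable X)
    (hY : Measurable Y) {x : ℝ} (hx : x ∈ rangeOf μ X) :
    ∃ d : ℝ≥0∞, d ≠ 0 ∧ d ≠ ∞ ∧ ∀ y, leftSup μ X Y x y * d ≤ μ.map Y (Ioi y) := by
  rcases eq_or_ne (μ.map X (Ioi x)) 0 with h0 | h0
  · refine ⟨μ.map X {x}, ?_, measure_ne_top _ _, fun y => ?_⟩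
    · have hx2 := ((mem_rangeOf_iff hX x).mp hx).2
      rw [← Ioi_union_left] at hx2
      exact fun h1 => hx2 (measure_union_null h0 h1)
    · rw [leftSup_eq_leftRatio hX,
        (h.intervalRatioMono hX hY y).leftRatio_mul_singleton (subLaw_le hX _)]
      exact subLaw_apply_le hX hY (measurableSet_singleton x) measurableSet_Ioi
  · have := (tendsto_measure_Ioc_atTop (μ.map X) x).eventually_ne h0
    obtain ⟨c, hc, hxc⟩ := (this.and (eventually_ge_atTop x)).exists
    refine ⟨μ.map X (Ioc x c), hc, measure_ne_top _ _, fun y => ?_⟩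
    rw [leftSup_eq_leftRatio hX]
    exact ((h.intervalRatioMono hX hY y).leftRatio_mul_le hxc).trans
      (subLaw_apply_le hX hY measurableSet_Ioc measurableSet_Ioi)

theorem RectangleTP2.exists_measure_Ioi_eq_leftSup (h : RectangleTP2 μ X Y) (hX : Measurable X)
    (hY : Measurable Y) {x : ℝ} (hx : x ∈ rangeOf μ X) :
    ∃ P : Measure ℝ, IsProbabilityMeasure P ∧ ∀ y, P (Ioi y) = leftSup μ X Y x y := by
  have hcond : ∀ (a y : ℝ), (cond μ (X ⁻¹' Ioc a x)) (Y ⁻¹' Ioi y) =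
      (cond μ (X ⁻¹' Ioc a x)).map Y (Ioi y) := fun a y =>
    (Measure.map_apply hY measurableSet_Ioi).symm
  apply exists_isProbabilityMeasure_Ioi
  · intro y z hyz
    exact iSup₂_mono fun a _ => measure_mono (preimage_mono (Ioi_subset_Ioi hyz))
  · change LowerSemicontinuous fun y => leftSup μ X Y x y
    simp only [leftSup, hcond]
    exact lowerSemicontinuous_biSup fun a _ => lowerSemicontinuous_measure_Ioi _
  -- A single conditioning interval of positive mass already forces the limit 1.
  · obtain ⟨a, hax, ha⟩ := exists_measure_Ioc_ne_zero hX hx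
    rw [Measure.map_apply hX measurableSet_Ioc] at ha
    have := cond_isProbabilityMeasure ha
    have hlim := tendsto_measure_Ioi_atBot ((cond μ (X ⁻¹' Ioc a x)).map Y)
    rw [Measure.map_apply hY .univ, preimage_univ, measure_univ] at hlim
    refine tendsto_of_tendsto_of_tendsto_of_le_of_le hlim tendsto_const_nhds (fun y => ?_)
      fun y => ?_
    · simp only [leftSup, hcond]
      exact le_iSup₂ (f := fun a (_ : a ∈ Iio x) => (cond μ (X ⁻¹' Ioc a x)).map Y (Ioi y)) a hax
    · simp only [leftSup_eq_leftRatio hX]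
      exact leftRatio_le_one (subLaw_le hX _) x
  · obtain ⟨d, hd0, hdt, hd⟩ := h.exists_leftSup_mul_le hX hY hx
    have hlim : Tendsto (fun y => μ.map Y (Ioi y) / d) atTop (𝓝 0) := by
      simpa using ENNReal.Tendsto.div_const (tendsto_measure_Ioi_atTop (μ.map Y)) (.inr hd0)
    exact tendsto_of_tendsto_of_tendsto_of_le_of_le tendsto_const_nhds hlim (fun y => zero_le)
      fun y => (ENNReal.le_div_iff_mul_le (.inl hd0) (.inl hdt)).mpr (hd y)

/-- For fixed A both sides are finite measures in B; they agree on the half-lines (y, ∞) by the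
density theorem, and in total mass. -/
theorem IsExplicitKernel.isCondKernel {K : Kernel ℝ ℝ} [IsMarkovKernel K]
    (hK : IsExplicitKernel μ X Y K) (h : RectangleTP2 μ X Y) (hX : Measurable X)
    (hY : Measurable Y) : IsCondKernel μ X Y K := by
  refine ⟨inferInstance, fun A B hA hB => ?_⟩
  rw [lintegral_indicator_comp_eq hX K hA hB, ← subLaw_apply hX B hA,
    subLaw_apply_eq_map_restrict hX hY hA hB,
    ← Measure.bind_apply hB K.measurable.aemeasurable]
  congr 1
  refine ext_of_generate_finite _ ((BorelSpace.measurable_eq).trans (borel_eq_generateFrom_Ioi ℝ))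
    isPiSystem_Ioi ?_ ?_
  · rintro _ ⟨y, rfl⟩
    rw [← subLaw_apply_eq_map_restrict hX hY hA measurableSet_Ioi,
      Measure.bind_apply measurableSet_Ioi K.measurable.aemeasurable]
    conv_lhs => rw [(h.intervalRatioMono hX hY y).eq_withDensity_leftRatio (subLaw_le hX _),
      withDensity_apply _ hA]
    refine lintegral_congr_ae (ae_restrict_of_ae ?_)
    filter_upwards [ae_mem_rangeOf hX] with x hx
    rw [hK.1 x hx, leftSup_eq_leftRatio hX]
  · rw [Measure.bind_apply .univ K.measurable.aemeasurable]
    simp [Measure.map_apply hY .univ, Measure.map_apply hX hA]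

theorem IsExplicitKernel.tendsto_measure_Ioc {K : Kernel ℝ ℝ} [IsMarkovKernel K]
    (hK : IsExplicitKernel μ X Y K) (h : RectangleTP2 μ X Y) (hX : Measurable X)
    (hY : Measurable Y) {x : ℝ} (hx : x ∈ rangeOf μ X) {y z : ℝ} (hyz : y ≤ z) :
    Tendsto (fun a : {a // a < x ∧ μ.map X (Ioc a x) ≠ 0} =>
      subLaw μ X Y (Ioc y z) (Ioc a x) / μ.map X (Ioc a x)) atTop (𝓝 (K x (Ioc y z))) := by
  have hlim : ∀ y, Tendsto (fun a : {a // a < x ∧ μ.map X (Ioc a x) ≠ 0} =>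
      subLaw μ X Y (Ioi y) (Ioc a x) / μ.map X (Ioc a x)) atTop (𝓝 (K x (Ioi y))) := fun y => by
    rw [hK.1 x hx, leftSup_eq_leftRatio hX]
    exact (h.intervalRatioMono hX hY y).tendsto_leftRatio (subLaw_le hX _) x
  have hdiff : ∀ (m : Measure ℝ) [IsFiniteMeasure m], m (Ioc y z) = m (Ioi y) - m (Ioi z) :=
    fun m _ => by
      rw [← Ioi_sdiff_Ioi, measure_sdiff (Ioi_subset_Ioi hyz) nullMeasurableSet_Ioi
        (measure_ne_top _ _)]
  rw [hdiff (K x)]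
  refine (ENNReal.Tendsto.sub (hlim y) (hlim z) (.inl (measure_ne_top _ _))).congr fun a => ?_
  rw [← ENNReal.sub_div fun _ _ => a.2.2]
  simp only [subLaw_apply_eq_map_restrict hX hY measurableSet_Ioc measurableSet_Ioc,
    subLaw_apply_eq_map_restrict hX hY measurableSet_Ioc measurableSet_Ioi, hdiff]

/-- If (x₁, x₂] has no X-mass, the two kernels coincide. Otherwise the product inequality follows
from rectangles (a₁, x₁] and (a₂, x₂], letting a₂ and then a₁ increase. -/
theorem IsExplicitKernel.isLRIsotonic {K : Kernel ℝ ℝ} [IsMarkovKernel K]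
    (hK : IsExplicitKernel μ X Y K) (h : RectangleTP2 μ X Y) (hX : Measurable X)
    (hY : Measurable Y) : IsLRIsotonic μ X K := by
  intro x₁ hx₁ x₂ hx₂ hx
  rcases eq_or_ne (μ.map X (Ioc x₁ x₂)) 0 with h0 | h0
  · have : K x₁ = K x₂ := by
      refine ext_of_generate_finite _
        ((BorelSpace.measurable_eq).trans (borel_eq_generateFrom_Ioi ℝ)) isPiSystem_Ioi ?_ (by simp)
      rintro _ ⟨y, rfl⟩
      rw [hK.1 x₁ hx₁, hK.1 x₂ hx₂, leftSup_eq_leftRatio hX, leftSup_eq_leftRatio hX]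
      exact (h.intervalRatioMono hX hY y).leftRatio_eq_of_null (subLaw_le hX _) hx h0
    rw [this]
    exact LikelihoodRatioLE.refl _
  refine likelihoodRatioLE_of_Ioc fun a b c hab hbc => ?_
  have hne : ∀ x ∈ rangeOf μ X, Nonempty {a // a < x ∧ μ.map X (Ioc a x) ≠ 0} := fun x hx => by
    obtain ⟨a, ha, ha'⟩ := exists_measure_Ioc_ne_zero hX hx
    exact ⟨a, ha, ha'⟩
  have := hne x₁ hx₁
  have := hne x₂ hx₂
  have hlim := fun {x} (hx : x ∈ rangeOf μ X) {y z} (hyz : y ≤ z) =>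
    hK.tendsto_measure_Ioc h hX hY hx hyz
  have hfin : ∀ (ν : Measure ℝ) [IsFiniteMeasure ν] {x : ℝ}
      (a : {a // a < x ∧ μ.map X (Ioc a x) ≠ 0}), ν (Ioc a x) / μ.map X (Ioc a x) ≠ ∞ :=
    fun ν _ x a => ENNReal.div_ne_top (measure_ne_top _ _) a.2.2
  refine le_of_tendsto_of_tendsto'
    (ENNReal.Tendsto.mul_const (hlim hx₁ hbc.le) (.inr (measure_ne_top _ _)))
    (ENNReal.Tendsto.mul_const (hlim hx₁ hab.le) (.inr (measure_ne_top _ _))) fun a₁ => ?_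
  refine le_of_tendsto_of_tendsto
    (ENNReal.Tendsto.const_mul (hlim hx₂ hab.le) (.inr (hfin _ _)))
    (ENNReal.Tendsto.const_mul (hlim hx₂ hbc.le) (.inr (hfin _ _))) ?_
  -- `h0` makes x₁ an admissible index, so eventually x₁ ≤ a₂ and the two intervals are ordered.
  filter_upwards [eventually_ge_atTop ⟨x₁, hx, h0⟩] with a₂ ha₂
  have hTP := h.of_le hX a₁.2.1 ha₂ a₂.2.1 hab hbc
  simp only [TP2Ineq, ← subLaw_apply hX _ measurableSet_Ioc] at hTP
  simp only [div_eq_mul_inv]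
  rw [mul_mul_mul_comm, mul_mul_mul_comm (subLaw μ X Y (Ioc a b) (Ioc a₁ x₁))]
  gcongr

theorem IsCondKernel.tp2Ineq {K : Kernel ℝ ℝ} (hK : IsCondKernel μ X Y K)
    (hLR : IsLRIsotonic μ X K) (hX : Measurable X) {A₁ A₂ B₁ B₂ : Set ℝ} (hA₁ : MeasurableSet A₁)
    (hA₂ : MeasurableSet A₂) (hB₁ : MeasurableSet B₁) (hB₂ : MeasurableSet B₂)
    (hA : SetLT A₁ A₂) (hB : SetLT B₁ B₂) : TP2Ineq μ X Y A₁ A₂ B₁ B₂ := by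
  have hdis := fun {A B : Set ℝ} (hA : MeasurableSet A) (hB : MeasurableSet B) =>
    (hK.disintegrate A B hA hB).trans (lintegral_indicator_comp_eq hX K hA hB)
  rw [TP2Ineq, hdis hA₁ hB₁, hdis hA₁ hB₂, hdis hA₂ hB₁, hdis hA₂ hB₂]
  refine lintegral_mul_lintegral_mono (K.measurable_coe hB₂) (K.measurable_coe hB₁)
    (K.measurable_coe hB₁) (K.measurable_coe hB₂) ?_
  filter_upwards [ae_restrict_mem hA₁, ae_restrict_of_ae (ae_mem_rangeOf hX)] with s hs hs'
  filter_upwards [ae_restrict_mem hA₂, ae_restrict_of_ae (ae_mem_rangeOf hX)] with t ht ht'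
  exact (hLR s hs' t ht' (hA s hs t ht)).measure_mul_le hB₁ hB₂ hB

theorem setLT_Ioc (a b c : ℝ) : SetLT (Ioc a b) (Ioc b c) :=
  fun _ hs _ ht => hs.2.trans_lt ht.1

end

/-! ### Existence of the kernel and conclusion -/

theorem RectangleTP2.exists_explicit_kernel {Ω : Type*} [MeasurableSpace Ω] {μ : Measure Ω}
    [IsProbabilityMeasure μ] {X Y : Ω → ℝ} (h : RectangleTP2 μ X Y) (hX : Measurable X)
    (hY : Measurable Y) :
    ∃ K : Kernel ℝ ℝ, IsMarkovKernel K ∧ IsExplicitKernel μ X Y K := by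
  have hex : ∀ x, ∃ P : Measure ℝ, IsProbabilityMeasure P ∧
      (x ∈ rangeOf μ X → ∀ y, P (Ioi y) = leftSup μ X Y x y) ∧
      (x ∉ rangeOf μ X → P = μ.map Y) := by
    intro x
    by_cases hx : x ∈ rangeOf μ X
    · obtain ⟨P, hP, hPy⟩ := h.exists_measure_Ioi_eq_leftSup hX hY hx
      exact ⟨P, hP, fun _ => hPy, fun hx' => absurd hx hx'⟩
    · exact ⟨μ.map Y, Measure.isProbabilityMeasure_map hY.aemeasurable, fun hx' => absurd hx' hx,
        fun _ => rfl⟩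
  choose κ hκ hκ₁ hκ₂ using hex
  -- Half-lines suffice, and on the range x ↦ κ x (y, ∞) is a monotone left ratio.
  have hmeas : Measurable κ := by
    refine Measurable.measure_of_isPiSystem_of_isProbabilityMeasure
      ((BorelSpace.measurable_eq).trans (borel_eq_generateFrom_Ioi ℝ)) isPiSystem_Ioi ?_
    rintro _ ⟨y, rfl⟩
    classical
    have : (fun x => κ x (Ioi y)) =
        (rangeOf μ X).piecewise (leftRatio (subLaw μ X Y (Ioi y)) (μ.map X))
          fun _ => μ.map Y (Ioi y) := by
      ext x
      by_cases hx : x ∈ rangeOf μ X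
      · rw [piecewise_eq_of_mem _ _ _ hx, hκ₁ x hx, leftSup_eq_leftRatio hX]
      · rw [piecewise_eq_of_notMem _ _ _ hx, hκ₂ x hx]
    rw [this]
    exact Measurable.piecewise (measurableSet_rangeOf X)
      ((h.intervalRatioMono hX hY y).leftRatio_mono (subLaw_le hX _)).measurable measurable_const
  exact ⟨⟨κ, hmeas⟩, ⟨hκ⟩, hκ₁, hκ₂⟩

end LRKernel

theorem theorem2 {Ω : Type*} [MeasurableSpace Ω] (μ : Measure Ω) [IsProbabilityMeasure μ]
    (X Y : Ω → ℝ) (hX : Measurable X) (hY : Measurable Y) :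
    List.TFAE [
      ∀ A₁ A₂ B₁ B₂ : Set ℝ, MeasurableSet A₁ → MeasurableSet A₂ → MeasurableSet B₁ →
        MeasurableSet B₂ → LRKernel.SetLT A₁ A₂ → LRKernel.SetLT B₁ B₂ →
        LRKernel.TP2Ineq μ X Y A₁ A₂ B₁ B₂,
      ∀ x₀ x₁ x₂ y₀ y₁ y₂ : ℝ, x₀ < x₁ → x₁ < x₂ → y₀ < y₁ → y₁ < y₂ →
        LRKernel.TP2Ineq μ X Y (Ioc x₀ x₁) (Ioc x₁ x₂) (Ioc y₀ y₁) (Ioc y₁ y₂),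
      ∃ K : Kernel ℝ ℝ, LRKernel.IsCondKernel μ X Y K ∧ LRKernel.IsLRIsotonic μ X K] ∧
    ((∀ x₀ x₁ x₂ y₀ y₁ y₂ : ℝ, x₀ < x₁ → x₁ < x₂ → y₀ < y₁ → y₁ < y₂ →
        LRKernel.TP2Ineq μ X Y (Ioc x₀ x₁) (Ioc x₁ x₂) (Ioc y₀ y₁) (Ioc y₁ y₂)) →
      ∃ K : Kernel ℝ ℝ, LRKernel.IsExplicitKernel μ X Y K ∧ LRKernel.IsCondKernel μ X Y K ∧
        LRKernel.IsLRIsotonic μ X K) := by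
  have main : LRKernel.RectangleTP2 μ X Y →
      ∃ K : Kernel ℝ ℝ, LRKernel.IsExplicitKernel μ X Y K ∧ LRKernel.IsCondKernel μ X Y K ∧
        LRKernel.IsLRIsotonic μ X K := fun h => by
    obtain ⟨K, _, hK⟩ := h.exists_explicit_kernel hX hY
    exact ⟨K, hK, hK.isCondKernel h hX hY, hK.isLRIsotonic h hX hY⟩
  refine ⟨?_, main⟩
  tfae_have 1 → 2 := fun h x₀ x₁ x₂ y₀ y₁ y₂ _ _ _ _ =>
    h _ _ _ _ measurableSet_Ioc measurableSet_Ioc measurableSet_Ioc measurableSet_Ioc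
      (LRKernel.setLT_Ioc x₀ x₁ x₂) (LRKernel.setLT_Ioc y₀ y₁ y₂)
  tfae_have 2 → 3 := fun h =>
    let ⟨K, _, hK⟩ := main h
    ⟨K, hK⟩
  tfae_have 3 → 1 := fun ⟨_, hK, hLR⟩ _ _ _ _ hA₁ hA₂ hB₁ hB₂ hA hB =>
    hK.tp2Ineq hLR hX hA₁ hA₂ hB₁ hB₂ hA hB
  tfae_finish
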